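/- Let $\mathbb{D}$ be the open unit disc, $\mathbb{T}$ the unit circle with normalised Lebesgue measure, $L^2=L^2(\mathbb{T})$, and $H^2\subset L^2$ the Hardy space of functions whose Fourier coefficients of negative index vanish. A function $f\in H^2$ has the values $f(\lambda)=\sum_{n\ge 0}\hat f(n)\lambda^n$ for $\lambda\in\mathbb{D}$, and $f(t)=\lim_{r\to 1^-}f(rt)$ for those $t\in\mathbb{T}$ for which the limit exists. Let $\theta$ be a Blaschke product of order 3, that is, $\theta(z)=c\prod_{i=1}^3\frac{z-a_i}{1-\overline{a_i}z}$ with $|c|=1$ and $a_1,a_2,a_3\in\mathbb{D}$ (not necessarily distinct). Let $K_\theta=H^2\ominus\theta H^2$ be its model space, $P_\theta:L^2\to K_\theta$ the orthogonal projection, and $C_\theta f=\theta\,\overline{zf}$ the canonical conjugation on $K_\theta$. A truncated Toeplitz operator (TTO) on $K_\theta$ is a bounded operator $A:K_\theta\to K_\theta$ for which there is a $\phi\in L^2$ with $Af=P_\theta(\phi f)$ for all $f\in K_\theta\cap L^\infty$. Let $v_1,v_2,v_3$ be a $C_\theta$-real basis of $K_\theta$, that is, an orthonormal basis with $C_\theta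 v_j=v_j$ for $j=1,2,3$. Then the radial limits $v_j(t)$ exist for every $t\in\mathbb{T}$. Moreover, let $t_1,t_2,t_3$ be distinct points of $\mathbb{T}$ and $\lambda_4,\lambda_5$ distinct points of $\mathbb{D}$. Then a complex symmetric matrix $$S=\begin{pmatrix} s_1&s_4&s_5\\ s_4&s_2&s_6\\ s_5&s_6&s_3\end{pmatrix},\qquad s_1,\dots,s_6\in\mathbb{C},$$ is the matrix of some TTO on $K_\theta$ with respect to $(v_1,v_2,v_3)$ if and only if $$\det[c_1,c_2,c_3,c_4,c_5,\tilde S]=0,$$ where the $6\times 6$ matrix has the columns $$c_i=\begin{pmatrix} v_1(t_i)\overline{v_1(t_i)}\\ v_2(t_i)\overline{v_2(t_i)}\\ v_3(t_i)\overline{v_3(t_i)}\\ v_1(t_i)\overline{v_2(t_i)}\\ v_1(t_i)\overline{v_3(t_i)}\\ v_2(t_i)\overline{v_3(t_i)}\end{pmatrix}\ (i=1,2,3),\qquad c_i=\begin{pmatrix} \overline{v_1(\lambda_i)v_1(\lambda_i)}\\ \overline{v_2(\lambda_i)v_2(\lambda_i)}\\ \overline{v_3(\lambda_i)v_3(\lambda_i)}\\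 \overline{v_1(\lambda_i)v_2(\lambda_i)}\\ \overline{v_1(\lambda_i)v_3(\lambda_i)}\\ \overline{v_2(\lambda_i)v_3(\lambda_i)}\end{pmatrix}\ (i=4,5),\qquad \tilde S=\begin{pmatrix}s_1\\s_2\\s_3\\s_4\\s_5\\s_6\end{pmatrix}.$$ -/

import Mathlib

open MeasureTheory Filter Topology
open scoped ENNReal ComplexConjugate

noncomputable section

namespace TTO

/-- The space `L²` of the unit circle with normalised Lebesgue measure. The circle is parametrised
by `x ∈ ℝ/ℤ` through `x ↦ AddCircle.toCircle x = exp (2πix)`. -/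
abbrev L2 : Type := Lp ℂ 2 (AddCircle.haarAddCircle : Measure UnitAddCircle)

/-- The independent variable `z`, as a function on the circle. -/
def zvar (x : UnitAddCircle) : ℂ := (AddCircle.toCircle x : ℂ)

/-- The Hardy space `H²` of the circle: the `L²` functions whose Fourier coefficients of negative
index vanish. -/
def hardy : Submodule ℂ L2 where
  carrier := {f | ∀ n : ℤ, n < 0 → fourierCoeff f n = 0}
  zero_mem' := by
    intro n _
    rw [← fourierBasis_repr]
    simp
  add_mem' := by
    intro f g hf hg n hn
    have h1 := hf n hn
    have h2 := hg n hn
    rw [← fourierBasis_repr] at h1 h2 ⊢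
    simp [h1, h2]
  smul_mem' := by
    intro c f hf n hn
    have h1 := hf n hn
    rw [← fourierBasis_repr] at h1 ⊢
    simp [h1]

theorem isClosed_hardy : IsClosed (hardy : Set L2) := by
  have h : (hardy : Set L2) = ⋂ n : ℤ, ⋂ _ : n < 0,
      {f : L2 | inner ℂ (fourierBasis (T := 1) n) f = 0} := by
    ext f
    simp only [Set.mem_iInter, Set.mem_ofPred_eq]
    constructor
    · intro hf n hn
      have h1 := hf n hn
      rwa [← fourierBasis_repr, HilbertBasis.repr_apply_apply] at h1
    · intro hf n hn
      have h1 := hf n hn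
      rwa [← HilbertBasis.repr_apply_apply, fourierBasis_repr] at h1
  rw [h]
  refine isClosed_iInter fun n => isClosed_iInter fun _ => ?_
  exact isClosed_eq (by fun_prop) continuous_const

/-- The subspace `θH²` of `L²`: all products `θh` with `h ∈ H²` (that lie in `L²`, which is
automatic when `θ` is an inner function). -/
def mulHardy (θ : ℂ → ℂ) : Submodule ℂ L2 where
  carrier := {g | ∃ h ∈ hardy, g =ᵐ[AddCircle.haarAddCircle] fun x => θ (zvar x) * h x}
  zero_mem' := by
    refine ⟨0, hardy.zero_mem, ?_⟩
    filter_upwards [Lp.coeFn_zero ℂ 2 (AddCircle.haarAddCircle : Measure UnitAddCircle)] with x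
    simp
  add_mem' := by
    rintro f g ⟨h, hh, hf⟩ ⟨k, hk, hg⟩
    refine ⟨h + k, hardy.add_mem hh hk, ?_⟩
    filter_upwards [hf, hg, Lp.coeFn_add f g, Lp.coeFn_add h k] with x h1 h2 h3 h4
    rw [h3, h4, Pi.add_apply, Pi.add_apply, h1, h2, mul_add]
  smul_mem' := by
    rintro c f ⟨h, hh, hf⟩
    refine ⟨c • h, hardy.smul_mem c hh, ?_⟩
    filter_upwards [hf, Lp.coeFn_smul c f, Lp.coeFn_smul c h] with x h1 h2 h3
    rw [h2, h3, Pi.smul_apply, Pi.smul_apply, h1, smul_eq_mul, smul_eq_mul]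
    ring

/-- The model space `K_θ = H² ⊖ θH²`. -/
def modelSpace (θ : ℂ → ℂ) : Submodule ℂ L2 := hardy ⊓ (mulHardy θ)ᗮ

theorem isClosed_modelSpace (θ : ℂ → ℂ) : IsClosed (modelSpace θ : Set L2) :=
  isClosed_hardy.inter (Submodule.isClosed_orthogonal _)

instance completeSpace_modelSpace (θ : ℂ → ℂ) : CompleteSpace (modelSpace θ) :=
  (isClosed_modelSpace θ).completeSpace_coe

/-- `θ` is (on the closed unit disc) a Blaschke product of order `n`: a unimodular constant times
`n` Blaschke factors, with zeros in the open disc that may be repeated. -/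
def IsBlaschkeProduct (n : ℕ) (θ : ℂ → ℂ) : Prop :=
  ∃ (c : Circle) (a : Fin n → Complex.UnitDisc), ∀ z : ℂ, ‖z‖ ≤ 1 →
    θ z = (c : ℂ) * ∏ i, (z - (a i : ℂ)) / (1 - conj (a i : ℂ) * z)

/-- The canonical conjugation `f ↦ θ * conj (z f)` of the model space, as functions on the
circle. -/
def modelConj (θ : ℂ → ℂ) (f : UnitAddCircle → ℂ) (x : UnitAddCircle) : ℂ :=
  θ (zvar x) * conj (zvar x * f x)

/-- The orthonormal basis `v` of `K_θ` is `C_θ`-real: each vector is fixed by the canonical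
conjugation (an equality of elements of `L²`, that is, almost everywhere on the circle). -/
def IsConjReal {θ : ℂ → ℂ} {ι : Type*} [Fintype ι]
    (v : OrthonormalBasis ι ℂ (modelSpace θ)) : Prop :=
  ∀ j, modelConj θ (v j : L2) =ᵐ[AddCircle.haarAddCircle] (v j : L2)

/-- The bounded operator `A` on `K_θ` is a truncated Toeplitz operator: for some symbol `φ ∈ L²`,
`A f = P_θ (φ f)` for all bounded `f ∈ K_θ`, with `P_θ` the orthogonal projection of `L²`
onto `K_θ`. -/
def IsTruncatedToeplitz (θ : ℂ → ℂ) (A : modelSpace θ →L[ℂ] modelSpace θ) : Prop :=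
  ∃ φ : L2, ∀ (f : modelSpace θ)
    (hf : MemLp ((f : L2) : UnitAddCircle → ℂ) ∞ AddCircle.haarAddCircle),
    A f = (modelSpace θ).orthogonalProjectionOnto
      ((hf.mul (Lp.memLp φ) : MemLp ((φ : UnitAddCircle → ℂ) * ((f : L2) : UnitAddCircle → ℂ))
        2 AddCircle.haarAddCircle).toLp)

/-- The value at a point `z` of the open unit disc of (the analytic extension to the disc of) a
function `f ∈ H²`. -/
def discValue (f : L2) (z : ℂ) : ℂ := ∑' n : ℕ, fourierCoeff f (n : ℤ) * z ^ n

/-- The value at a point `t` of the unit circle of a function `f ∈ H²`, as a radial limit. -/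
def circleValue (f : L2) (t : Circle) : ℂ :=
  limUnder (𝓝[<] (1 : ℝ)) fun r : ℝ => discValue f ((r : ℂ) * (t : ℂ))

/-- The column `c_i`, `i = 1, 2, 3`, in terms of `w = (v₁(t_i), v₂(t_i), v₃(t_i))`. -/
def circleColumn (w : Fin 3 → ℂ) : Fin 6 → ℂ :=
  ![w 0 * conj (w 0), w 1 * conj (w 1), w 2 * conj (w 2),
    w 0 * conj (w 1), w 0 * conj (w 2), w 1 * conj (w 2)]

/-- The column `c_i`, `i = 4, 5`, in terms of `w = (v₁(λ_i), v₂(λ_i), v₃(λ_i))`. -/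
def discColumn (w : Fin 3 → ℂ) : Fin 6 → ℂ :=
  ![conj (w 0 * w 0), conj (w 1 * w 1), conj (w 2 * w 2),
    conj (w 0 * w 1), conj (w 0 * w 2), conj (w 1 * w 2)]

/-- The square matrix with given columns. -/
def ofColumns (c : Fin 6 → Fin 6 → ℂ) : Matrix (Fin 6) (Fin 6) ℂ :=
  Matrix.of fun i j => c j i

end TTO

end

/-! Let `q` be the denominator of `θ`. If `f ∈ H²` and `C_θ f = f`, then `q f` is a polynomial `p`
of degree at most 2 whose coefficients satisfy `p_k = c * conj p_{2-k}` (`exists_numerator`). Hence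
`conj f * g = w p_f p_g` on the circle, with one nonvanishing weight `w` for all such `f`, `g`. The
matrix of the operator with symbol `φ` thus depends only on the five moments `∫ w z^m φ`, `m ≤ 4`:
it is `α H αᵀ`, with `H` their Hankel matrix and the numerators of the basis as the rows of `α`.
Every moment vector occurs, so these matrices form the image of an injective linear map on `ℂ⁵`
(`exists_isTruncatedToeplitz_toMatrix_eq_iff`).

Evaluation of binary quartic forms at a point of the projective line is one such moment functional,
and its matrix has rank one. Up to nonzero factors, the columns `c_i` come from evaluation at `(t_i,
1)` and, by the symmetry of the numerators, at `(1, conj λ_i)`. These five points are distinct, so a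
projective Vandermonde determinant makes the columns a basis of the image. The determinant condition
says that the last column lies in their span. -/

namespace TTO

/-! ### Binary forms, Hankel matrices and the projective Vandermonde determinant -/

/-- The value at `(x, y)` of the binary quadratic form with coefficients `a`. -/
def formEval (a : Fin 3 → ℂ) (x y : ℂ) : ℂ := ∑ k : Fin 3, a k * (x ^ (k : ℕ) * y ^ (k.rev : ℕ))

/-- The `3 × 3` Hankel matrix of a sequence of length `5`. -/
def hankel : (Fin 5 → ℂ) →ₗ[ℂ] Matrix (Fin 3) (Fin 3) ℂ where
  toFun l := Matrix.of fun i j => l ⟨i + j, by omega⟩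
  map_add' _ _ := rfl
  map_smul' _ _ := rfl

theorem hankel_apply (l : Fin 5 → ℂ) (i j : Fin 3) : hankel l i j = l ⟨i + j, by omega⟩ := rfl

/-- The entries of a `3 × 3` matrix on and above the diagonal, in the order in which they are
listed in the columns `c_i`. -/
def upperEntries : Matrix (Fin 3) (Fin 3) ℂ →ₗ[ℂ] (Fin 6 → ℂ) where
  toFun M := ![M 0 0, M 1 1, M 2 2, M 0 1, M 0 2, M 1 2]
  map_add' M N := by ext i; fin_cases i <;> rfl
  map_smul' c M := by ext i; fin_cases i <;> rfl

theorem upperEntries_injOn_isSymm {M N : Matrix (Fin 3) (Fin 3) ℂ} (hM : M.IsSymm)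
    (hN : N.IsSymm) (h : upperEntries M = upperEntries N) : M = N := by
  have h' := fun i => congrFun h i
  have h0 := h' 0
  have h1 := h' 1
  have h2 := h' 2
  have h3 := h' 3
  have h4 := h' 4
  have h5 := h' 5
  change M 0 0 = N 0 0 at h0
  change M 1 1 = N 1 1 at h1
  change M 2 2 = N 2 2 at h2
  change M 0 1 = N 0 1 at h3
  change M 0 2 = N 0 2 at h4
  change M 1 2 = N 1 2 at h5
  have e := hM.apply
  have e' := hN.apply
  ext i j
  fin_cases i <;> fin_cases j
  · exact h0
  · exact h3
  · exact h4
  · exact (e 0 1).trans (h3.trans (e' 0 1).symm)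
  · exact h1
  · exact h5
  · exact (e 0 2).trans (h4.trans (e' 0 2).symm)
  · exact (e 1 2).trans (h5.trans (e' 1 2).symm)
  · exact h2

/-- The map taking a linear functional on polynomials of degree at most `4`, given by its values
`l` at the monomials, to the matrix of its values at the products of the polynomials whose
coefficients are the rows of `α`. -/
def congrHankel (α : Matrix (Fin 3) (Fin 3) ℂ) :
    (Fin 5 → ℂ) →ₗ[ℂ] Matrix (Fin 3) (Fin 3) ℂ where
  toFun l := α * hankel l * α.transpose
  map_add' l m := by rw [map_add, mul_add, add_mul]
  map_smul' c l := by simp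

theorem congrHankel_apply (α : Matrix (Fin 3) (Fin 3) ℂ) (l : Fin 5 → ℂ) (j k : Fin 3) :
    congrHankel α l j k =
      ∑ a : Fin 3, ∑ b : Fin 3, α j a * α k b * l ⟨a + b, by omega⟩ := by
  simp only [congrHankel, LinearMap.coe_mk, AddHom.coe_mk, Matrix.mul_apply,
    Matrix.transpose_apply, hankel_apply, Finset.sum_mul]
  rw [Finset.sum_comm]
  refine Finset.sum_congr rfl fun a _ => Finset.sum_congr rfl fun b _ => ?_
  ring

theorem isSymm_congrHankel (α : Matrix (Fin 3) (Fin 3) ℂ) (l : Fin 5 → ℂ) :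
    (congrHankel α l).IsSymm := by
  have h : (hankel l).IsSymm := by
    ext i j
    simp [hankel_apply, add_comm]
  simp only [congrHankel, LinearMap.coe_mk, AddHom.coe_mk, Matrix.IsSymm, Matrix.transpose_mul,
    Matrix.transpose_transpose, h.eq, mul_assoc]

theorem hankel_injective : Function.Injective hankel := by
  intro l m h
  have h' := fun i j => congrFun (congrFun h i) j
  ext i
  fin_cases i
  · exact h' 0 0
  · exact h' 0 1
  · exact h' 0 2
  · exact h' 1 2
  · exact h' 2 2

theorem congrHankel_injective {α : Matrix (Fin 3) (Fin 3) ℂ} (hα : IsUnit α) :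
    Function.Injective (congrHankel α) := by
  intro l m h
  have hT : IsUnit α.transpose := by
    rw [Matrix.isUnit_iff_isUnit_det] at hα ⊢
    rwa [Matrix.det_transpose]
  exact hankel_injective (hα.mul_left_cancel (hT.mul_right_cancel h))

theorem upperEntries_comp_congrHankel_injective {α : Matrix (Fin 3) (Fin 3) ℂ} (hα : IsUnit α) :
    Function.Injective (upperEntries ∘ₗ congrHankel α) := fun l m h =>
  congrHankel_injective hα
    (upperEntries_injOn_isSymm (isSymm_congrHankel α l) (isSymm_congrHankel α m) h)

/-- A Vandermonde row lists the quartic monomials at one point, so its functional is evaluation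
there, which is multiplicative. -/
theorem congrHankel_projVandermonde (α : Matrix (Fin 3) (Fin 3) ℂ) (x y : Fin 5 → ℂ) (i : Fin 5)
    (j k : Fin 3) :
    congrHankel α (Matrix.projVandermonde x y i) j k =
      formEval (α j) (x i) (y i) * formEval (α k) (x i) (y i) := by
  rw [congrHankel_apply, formEval, formEval, Finset.sum_mul_sum]
  refine Finset.sum_congr rfl fun a _ => Finset.sum_congr rfl fun b _ => ?_
  rw [Matrix.projVandermonde_apply]
  -- The exponents of `y` agree because `4 - (a + b) = (2 - a) + (2 - b)`.
  have h : ((Fin.rev (⟨a + b, by omega⟩ : Fin 5) : Fin 5) : ℕ) = a.rev + b.rev := by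
    simp only [Fin.val_rev]
    omega
  rw [h, pow_add, pow_add]
  ring

/-- The hypothesis says that the points `(x i : y i)` are pairwise distinct on the projective line,
so no factor of the determinant vanishes. -/
theorem linearIndependent_projVandermonde {x y : Fin 5 → ℂ}
    (h : ∀ i j, i < j → x j * y i ≠ x i * y j) :
    LinearIndependent ℂ (Matrix.projVandermonde x y).row := by
  rw [Matrix.linearIndependent_rows_iff_isUnit, Matrix.isUnit_iff_isUnit_det,
    Matrix.det_projVandermonde, isUnit_iff_ne_zero]
  refine Finset.prod_ne_zero_iff.2 fun i _ => Finset.prod_ne_zero_iff.2 fun j hj => ?_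
  exact sub_ne_zero.2 (h i j (Finset.mem_Ioi.1 hj))

/-- Five independent vectors in a five-dimensional range span it, so the sixth column is dependent
on them exactly when it lies in the range. -/
theorem det_ofColumns_snoc_eq_zero_iff (L : (Fin 5 → ℂ) →ₗ[ℂ] (Fin 6 → ℂ))
    (hL : Function.Injective L) {e : Fin 5 → Fin 5 → ℂ} (he : LinearIndependent ℂ e)
    {κ : Fin 5 → ℂ} (hκ : ∀ i, κ i ≠ 0) (s : Fin 6 → ℂ) :
    (ofColumns (Fin.snoc (fun i => κ i • L (e i)) s : Fin 6 → Fin 6 → ℂ)).det = 0 ↔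
      s ∈ LinearMap.range L := by
  set c : Fin 5 → Fin 6 → ℂ := fun i => κ i • L (e i) with hc
  have hLe : LinearIndependent ℂ (L ∘ e) := he.map' L (LinearMap.ker_eq_bot.2 hL)
  have hli : LinearIndependent ℂ c := hLe.units_smul fun i => Units.mk0 (κ i) (hκ i)
  have hspan : Submodule.span ℂ (Set.range c) = LinearMap.range L := by
    refine Submodule.eq_of_le_of_finrank_eq ?_ ?_
    · rw [Submodule.span_le]
      rintro _ ⟨i, rfl⟩
      exact Submodule.smul_mem _ _ (LinearMap.mem_range_self L _)
    · rw [finrank_span_eq_card hli, LinearMap.finrank_range_of_inj hL]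
      simp
  have hcol : (ofColumns (Fin.snoc c s : Fin 6 → Fin 6 → ℂ)).col = Fin.snoc c s := rfl
  rw [← hspan, ← not_iff_not, ← Ne.eq_def, ← isUnit_iff_ne_zero,
    ← Matrix.isUnit_iff_isUnit_det, ← Matrix.linearIndependent_cols_iff_isUnit, hcol,
    linearIndependent_finSnoc]
  simp [hli]

/-! ### Fourier coefficients and power series in the disc -/

theorem norm_zvar (x : UnitAddCircle) : ‖zvar x‖ = 1 := Circle.norm_coe _

theorem zvar_mul_conj (x : UnitAddCircle) : zvar x * conj (zvar x) = 1 := by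
  rw [Complex.mul_conj', norm_zvar]
  simp

@[fun_prop]
theorem continuous_zvar : Continuous zvar :=
  continuous_subtype_val.comp AddCircle.continuous_toCircle

theorem zvar_pow (n : ℕ) (x : UnitAddCircle) : zvar x ^ n = fourier (n : ℤ) x := by
  rw [fourier_apply, AddCircle.toCircle_zsmul, zvar]
  simp

theorem integrable_of_L2 (f : L2) : Integrable (f : UnitAddCircle → ℂ) AddCircle.haarAddCircle :=
  (Lp.memLp f).integrable (by norm_num)

theorem memLp_continuous {g : UnitAddCircle → ℂ} (hg : Continuous g) (p : ℝ≥0∞) :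
    MemLp g p AddCircle.haarAddCircle := by
  obtain ⟨C, hC⟩ := isCompact_univ.exists_bound_of_continuousOn hg.continuousOn
  exact MemLp.of_bound hg.aestronglyMeasurable C (ae_of_all _ fun x => hC x (Set.mem_univ x))

theorem memLp_continuous_mul {g : UnitAddCircle → ℂ} (hg : Continuous g)
    {f : UnitAddCircle → ℂ} {p : ℝ≥0∞} (hf : MemLp f p AddCircle.haarAddCircle) :
    MemLp (fun x => g x * f x) p AddCircle.haarAddCircle :=
  hf.mul (memLp_continuous hg ∞)

theorem fourierCoeff_polynomial_mul (Q : Polynomial ℂ) {f : UnitAddCircle → ℂ}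
    (hf : Integrable f AddCircle.haarAddCircle) (n : ℤ) :
    fourierCoeff (fun x => Q.eval (zvar x) * f x) n =
      ∑ i ∈ Finset.range (Q.natDegree + 1), Q.coeff i * fourierCoeff f (n - i) := by
  simp only [fourierCoeff, smul_eq_mul]
  simp_rw [← integral_const_mul]
  rw [← integral_finsetSum]
  · refine integral_congr_ae (ae_of_all _ fun x => ?_)
    simp only [Polynomial.eval_eq_sum_range, Finset.sum_mul, Finset.mul_sum]
    refine Finset.sum_congr rfl fun i _ => ?_
    rw [zvar_pow, show -(n - (i : ℤ)) = -n + i by ring, fourier_add]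
    ring
  · intro i _
    exact (hf.fourier_smul _).const_mul _

theorem fourierCoeff_conj (f : UnitAddCircle → ℂ) (n : ℤ) :
    fourierCoeff (fun x => conj (f x)) n = conj (fourierCoeff f (-n)) := by
  simp only [fourierCoeff, smul_eq_mul]
  rw [← integral_conj]
  refine integral_congr_ae (ae_of_all _ fun x => ?_)
  simp only [map_mul, ← fourier_neg, neg_neg]

theorem fourierCoeff_zvar_pow_mul (f : UnitAddCircle → ℂ) (m : ℕ) (n : ℤ) :
    fourierCoeff (fun x => zvar x ^ m * f x) n = fourierCoeff f (n - m) := by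
  simp only [fourierCoeff, smul_eq_mul]
  refine integral_congr_ae (ae_of_all _ fun x => ?_)
  simp only [zvar_pow]
  rw [show -(n - (m : ℤ)) = -n + m by ring, fourier_add, mul_assoc]

theorem norm_fourierCoeff_le (f : L2) (n : ℤ) : ‖fourierCoeff f n‖ ≤ ‖f‖ := by
  rw [← fourierBasis_repr, ← (fourierBasis (T := 1)).repr.norm_map f]
  exact lp.norm_apply_le_norm (by norm_num) _ n

theorem summable_fourierCoeff_mul_pow (f : L2) {z : ℂ} (hz : ‖z‖ < 1) :
    Summable fun n : ℕ => fourierCoeff f (n : ℤ) * z ^ n := by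
  refine Summable.of_norm_bounded
    ((summable_geometric_of_lt_one (norm_nonneg z) hz).mul_left ‖f‖) fun n => ?_
  rw [norm_mul, norm_pow]
  gcongr
  exact norm_fourierCoeff_le f n

theorem hasSum_shift_mul_pow {u : ℤ → ℂ} (hu : ∀ n < 0, u n = 0) {z F : ℂ}
    (h : HasSum (fun n : ℕ => u n * z ^ n) F) (i : ℕ) :
    HasSum (fun n : ℕ => u (n - i) * z ^ n) (z ^ i * F) := by
  rw [← (add_left_injective i).hasSum_iff]
  · convert! h.mul_left (z ^ i) using 2 with n
    simp only [Function.comp, Nat.cast_add, add_sub_cancel_right, pow_add]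
    ring
  · intro n hn
    have hlt : n < i := by
      by_contra hle
      exact hn ⟨n - i, Nat.sub_add_cancel (not_lt.1 hle)⟩
    rw [hu _ (by omega), zero_mul]

/-- Multiplication by a polynomial on the circle corresponds to multiplication in the disc, since no
term of negative index is shifted into the series. -/
theorem hasSum_polynomial_mul_discValue (Q : Polynomial ℂ) {f : L2} (hf : f ∈ hardy) {z : ℂ}
    (hz : ‖z‖ < 1) :
    HasSum (fun n : ℕ => fourierCoeff (fun x => Q.eval (zvar x) * f x) (n : ℤ) * z ^ n)
      (Q.eval z * discValue f z) := by
  have h := (summable_fourierCoeff_mul_pow f hz).hasSum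
  have h1 := hasSum_sum (s := Finset.range (Q.natDegree + 1)) fun i _ =>
    (hasSum_shift_mul_pow hf h i).mul_left (Q.coeff i)
  convert! h1 using 1
  · ext n
    rw [fourierCoeff_polynomial_mul Q (integrable_of_L2 f), Finset.sum_mul]
    exact Finset.sum_congr rfl fun i _ => mul_assoc _ _ _
  · rw [Polynomial.eval_eq_sum_range, Finset.sum_mul]
    exact Finset.sum_congr rfl fun i _ => mul_assoc _ _ _

theorem eq_sum_of_fourierCoeff_eq_zero {g : L2}
    (hg : ∀ n : ℤ, (∀ k : Fin 3, n ≠ (k : ℕ)) → fourierCoeff g n = 0) :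
    (g : UnitAddCircle → ℂ) =ᵐ[AddCircle.haarAddCircle]
      fun x => formEval (fun k => fourierCoeff g ((k : ℕ) : ℤ)) (zvar x) 1 := by
  have h := hasSum_fourier_series_L2 g
  have h1 := hasSum_sum_of_ne_finset_zero (L := .unconditional _)
    (s := Finset.univ.image fun k : Fin 3 => ((k : ℕ) : ℤ))
    (f := fun n : ℤ => fourierCoeff g n • fourierLp (T := 1) 2 n) (by
      intro n hn
      rw [hg n fun k hk => hn (Finset.mem_image.2 ⟨k, Finset.mem_univ _, hk.symm⟩), zero_smul])
  have h2 := h.unique h1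
  rw [Finset.sum_image fun i _ j _ hij => Fin.ext (by exact_mod_cast hij)] at h2
  have hk : ∀ n : ℤ, (fourierCoeff g n • fourierLp (T := 1) 2 n : L2) =ᵐ[AddCircle.haarAddCircle]
      fun x => fourierCoeff g n * fourier n x := by
    intro n
    filter_upwards [Lp.coeFn_smul (fourierCoeff g n) (fourierLp (T := 1) 2 n),
      coeFn_fourierLp (T := 1) 2 n] with x h3 h4
    rw [h3, Pi.smul_apply, h4, smul_eq_mul]
  have h3 : (g : UnitAddCircle → ℂ) =ᵐ[AddCircle.haarAddCircle] fun x => ∑ k : Fin 3,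
      (fourierCoeff g ((k : ℕ) : ℤ) • fourierLp (T := 1) 2 ((k : ℕ) : ℤ) : L2) x := by
    conv_lhs => rw [h2]
    exact Lp.coeFn_fun_finsetSum _ _
  filter_upwards [h3, ae_all_iff.2 fun k : Fin 3 => hk k] with x e1 e2
  rw [e1, formEval]
  refine Finset.sum_congr rfl fun k _ => ?_
  rw [e2 k, zvar_pow, one_pow, mul_one]

/-! ### Numerators of functions fixed by the conjugation -/

/-- The denominator of a Blaschke product with the zeros `a i`. -/
noncomputable def blaschkeDenom (a : Fin 3 → Complex.UnitDisc) : Polynomial ℂ :=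
  ∏ i, (1 - Polynomial.C (conj (a i : ℂ)) * Polynomial.X)

theorem eval_blaschkeDenom (a : Fin 3 → Complex.UnitDisc) (z : ℂ) :
    (blaschkeDenom a).eval z = ∏ i, (1 - conj (a i : ℂ) * z) := by
  simp [blaschkeDenom, Polynomial.eval_prod]

theorem one_sub_conj_mul_ne_zero (a : Complex.UnitDisc) {z : ℂ} (hz : ‖z‖ ≤ 1) :
    1 - conj (a : ℂ) * z ≠ 0 := by
  intro h
  have h1 : ‖conj (a : ℂ) * z‖ = 1 := by
    rw [← sub_eq_zero.1 h, norm_one]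
  have h2 : ‖conj (a : ℂ) * z‖ < 1 := by
    rw [norm_mul, RCLike.norm_conj]
    exact (mul_le_of_le_one_right (norm_nonneg _) hz).trans_lt a.norm_lt_one
  exact h2.ne h1

theorem eval_blaschkeDenom_ne_zero (a : Fin 3 → Complex.UnitDisc) {z : ℂ} (hz : ‖z‖ ≤ 1) :
    (blaschkeDenom a).eval z ≠ 0 := by
  rw [eval_blaschkeDenom]
  exact Finset.prod_ne_zero_iff.2 fun i _ => one_sub_conj_mul_ne_zero (a i) hz

/-- On the circle each factor satisfies `z - a = z * conj (1 - conj a * z)`. -/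
theorem blaschkeDenom_mul_blaschke (a : Fin 3 → Complex.UnitDisc) {z : ℂ} (hz : ‖z‖ = 1) :
    (blaschkeDenom a).eval z * ∏ i, (z - (a i : ℂ)) / (1 - conj (a i : ℂ) * z) =
      z ^ 3 * conj ((blaschkeDenom a).eval z) := by
  have hzz : z * conj z = 1 := by
    rw [Complex.mul_conj', hz]
    simp
  rw [eval_blaschkeDenom, ← Finset.prod_mul_distrib, map_prod]
  have h3 : z ^ 3 = ∏ _i : Fin 3, z := by simp
  rw [h3, ← Finset.prod_mul_distrib]
  refine Finset.prod_congr rfl fun i _ => ?_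
  rw [mul_div_cancel₀ _ (one_sub_conj_mul_ne_zero (a i) hz.le)]
  simp only [map_sub, map_one, map_mul, Complex.conj_conj]
  linear_combination (a i : ℂ) * hzz

/-- A function of `H²` fixed by the canonical conjugation is a quotient of polynomials with a
self-reciprocal numerator of degree at most `2`, on the circle and in the disc. -/
theorem exists_numerator {θ : ℂ → ℂ} {c : Circle} {a : Fin 3 → Complex.UnitDisc}
    (hθ : ∀ z : ℂ, ‖z‖ ≤ 1 → θ z = (c : ℂ) * ∏ i, (z - (a i : ℂ)) / (1 - conj (a i : ℂ) * z))
    {f : L2} (hf : f ∈ hardy) (hconj : modelConj θ f =ᵐ[AddCircle.haarAddCircle] f) :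
    ∃ α : Fin 3 → ℂ, (∀ k, α k = c * conj (α k.rev)) ∧
      (∀ᵐ x ∂AddCircle.haarAddCircle,
        (blaschkeDenom a).eval (zvar x) * f x = formEval α (zvar x) 1) ∧
      ∀ z : ℂ, ‖z‖ < 1 → (blaschkeDenom a).eval z * discValue f z = formEval α z 1 := by
  set Q := blaschkeDenom a
  set G : UnitAddCircle → ℂ := fun x => Q.eval (zvar x) * f x with hG
  have hGm : MemLp G 2 AddCircle.haarAddCircle :=
    memLp_continuous_mul (Q.continuous.comp continuous_zvar) (Lp.memLp f)
  have hGae : hGm.toLp =ᵐ[AddCircle.haarAddCircle] G := hGm.coeFn_toLp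
  have hcoeff : fourierCoeff hGm.toLp = fourierCoeff G := fourierCoeff_congr_ae hGae
  have hneg : ∀ n : ℤ, n < 0 → fourierCoeff G n = 0 := by
    intro n hn
    rw [hG, fourierCoeff_polynomial_mul Q (integrable_of_L2 f)]
    refine Finset.sum_eq_zero fun i _ => ?_
    rw [hf _ (by omega), mul_zero]
  -- The conjugation identity gives `G = c z² conj G`, which reflects the indices by `n ↦ 2 - n`.
  -- With `hneg`, only `n = 0, 1, 2` survive.
  have hsymm : ∀ n : ℤ, fourierCoeff G n = c * conj (fourierCoeff G (2 - n)) := by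
    intro n
    have h1 : G =ᵐ[AddCircle.haarAddCircle] fun x => c * (zvar x ^ 2 * conj (G x)) := by
      filter_upwards [hconj] with x hx
      have hb := blaschkeDenom_mul_blaschke a (norm_zvar x)
      have hz := zvar_mul_conj x
      rw [modelConj, hθ _ (norm_zvar x).le] at hx
      simp only [hG]
      conv_lhs => rw [← hx]
      simp only [map_mul]
      linear_combination (c * (conj (zvar x) * conj (f x))) * hb +
        (c * zvar x ^ 2 * conj (Q.eval (zvar x)) * conj (f x)) * hz
    conv_lhs => rw [fourierCoeff_congr_ae h1]
    rw [fourierCoeff.const_mul, fourierCoeff_zvar_pow_mul, fourierCoeff_conj]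
    congr 3
    push_cast
    ring
  have hzero : ∀ n : ℤ, (∀ k : Fin 3, n ≠ (k : ℕ)) → fourierCoeff G n = 0 := by
    intro n hn
    by_cases h0 : n < 0
    · exact hneg n h0
    · have h2 : 2 - n < 0 := by
        by_contra hle
        exact hn ⟨n.toNat, by omega⟩ (by simp only; omega)
      rw [hsymm, hneg _ h2, map_zero, mul_zero]
  refine ⟨fun k => fourierCoeff G ((k : ℕ) : ℤ), fun k => ?_, ?_, fun z hz => ?_⟩
  · have h2 : (2 : ℤ) - ((k : ℕ) : ℤ) = ((k.rev : ℕ) : ℤ) := by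
      rw [Fin.val_rev]
      omega
    exact (hsymm _).trans (by rw [h2])
  · have h := eq_sum_of_fourierCoeff_eq_zero (g := hGm.toLp) (by rwa [hcoeff])
    rw [hcoeff] at h
    filter_upwards [h, hGae] with x h1 h2
    rw [← h1, h2]
  · have h := hasSum_polynomial_mul_discValue Q hf hz
    have h1 := hasSum_sum_of_ne_finset_zero (L := .unconditional _) (s := Finset.range 3)
      (f := fun n : ℕ => fourierCoeff G (n : ℤ) * z ^ n) (by
        intro n hn
        rw [hzero n (fun k hk => hn (Finset.mem_range.2 (by omega))), zero_mul])
    rw [h.unique h1, formEval, Finset.sum_range]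
    simp

/-! ### Self-reciprocal forms and the weight -/

theorem formEval_sum_smul {ι : Type*} (s : Finset ι) (d : ι → ℂ) (α : ι → Fin 3 → ℂ) (x y : ℂ) :
    formEval (∑ j ∈ s, d j • α j) x y = ∑ j ∈ s, d j * formEval (α j) x y := by
  simp only [formEval, Finset.sum_apply, Pi.smul_apply, smul_eq_mul, Finset.sum_mul,
    Finset.mul_sum]
  rw [Finset.sum_comm]
  simp only [mul_assoc]

theorem formEval_mul_mul (α : Fin 3 → ℂ) (t x y : ℂ) :
    formEval α (t * x) (t * y) = t ^ 2 * formEval α x y := by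
  rw [formEval, formEval, Finset.mul_sum]
  refine Finset.sum_congr rfl fun k _ => ?_
  have h : t ^ 2 = t ^ (k : ℕ) * t ^ (k.rev : ℕ) := by
    rw [← pow_add, Fin.val_rev]
    congr 1
    omega
  rw [h, mul_pow, mul_pow]
  ring

theorem continuous_formEval (α : Fin 3 → ℂ) (y : ℂ) : Continuous fun x => formEval α x y := by
  unfold formEval
  fun_prop

/-- Reversing the coefficients swaps the two variables; this is what turns a conjugated value at `λ`
into a value at `(1, conj λ)`. -/
theorem conj_formEval {c : Circle} {α : Fin 3 → ℂ} (hα : ∀ k, α k = c * conj (α k.rev))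
    (x y : ℂ) : conj (formEval α x y) = conj (c : ℂ) * formEval α (conj y) (conj x) := by
  have hc : conj (c : ℂ) * c = 1 := by
    rw [Complex.conj_mul', Circle.norm_coe]
    simp
  rw [formEval, formEval, map_sum, Finset.mul_sum]
  refine Fintype.sum_equiv Fin.revPerm _ _ fun k => ?_
  simp only [Fin.revPerm_apply, map_mul, map_pow, Fin.rev_rev]
  rw [hα k.rev, Fin.rev_rev]
  linear_combination -(conj (α k) * conj x ^ (k : ℕ) * conj y ^ (k.rev : ℕ)) * hc

theorem conj_formEval_of_norm_eq_one {c : Circle} {α : Fin 3 → ℂ}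
    (hα : ∀ k, α k = c * conj (α k.rev)) {t : ℂ} (ht : ‖t‖ = 1) :
    conj (formEval α t 1) = conj (c : ℂ) * conj t ^ 2 * formEval α t 1 := by
  have htt : conj t * t = 1 := by
    rw [Complex.conj_mul', ht]
    simp
  rw [conj_formEval hα, mul_assoc, ← formEval_mul_mul, htt, map_one, mul_one]

/-- The function `w` on the circle for which `conj f * g = w * β * γ` whenever `f`, `g` are fixed
by the canonical conjugation and have the numerators `β`, `γ`. -/
noncomputable def circleWeight (c : Circle) (a : Fin 3 → Complex.UnitDisc) (t : ℂ) : ℂ :=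
  conj (c : ℂ) * conj t ^ 2 / (conj ((blaschkeDenom a).eval t) * (blaschkeDenom a).eval t)

theorem circleWeight_ne_zero (c : Circle) (a : Fin 3 → Complex.UnitDisc) {t : ℂ} (ht : ‖t‖ = 1) :
    circleWeight c a t ≠ 0 := by
  have hq := eval_blaschkeDenom_ne_zero a ht.le
  have h0 : t ≠ 0 := by
    rw [← norm_ne_zero_iff, ht]
    exact one_ne_zero
  exact div_ne_zero (mul_ne_zero ((map_ne_zero _).2 (Circle.coe_ne_zero c))
    (pow_ne_zero _ ((map_ne_zero _).2 h0))) (mul_ne_zero ((map_ne_zero _).2 hq) hq)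

theorem continuous_circleWeight_zvar (c : Circle) (a : Fin 3 → Complex.UnitDisc) :
    Continuous fun x => circleWeight c a (zvar x) := by
  have hq : Continuous fun x => (blaschkeDenom a).eval (zvar x) :=
    (blaschkeDenom a).continuous.comp continuous_zvar
  have hconj : ∀ {g : UnitAddCircle → ℂ}, Continuous g → Continuous fun x => conj (g x) :=
    fun hg => Complex.continuous_conj.comp hg
  refine (continuous_const.mul ((hconj continuous_zvar).pow 2)).div ((hconj hq).mul hq) fun x => ?_
  have h := eval_blaschkeDenom_ne_zero a (norm_zvar x).le
  exact mul_ne_zero ((map_ne_zero _).2 h) h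

theorem conj_div_mul_div {c : Circle} {a : Fin 3 → Complex.UnitDisc} {β : Fin 3 → ℂ}
    (hβ : ∀ k, β k = c * conj (β k.rev)) (γ : Fin 3 → ℂ) {t : ℂ} (ht : ‖t‖ = 1) :
    conj (formEval β t 1 / (blaschkeDenom a).eval t) *
        (formEval γ t 1 / (blaschkeDenom a).eval t) =
      circleWeight c a t * (formEval β t 1 * formEval γ t 1) := by
  rw [map_div₀, conj_formEval_of_norm_eq_one hβ ht, circleWeight, div_mul_div_comm,
    div_mul_eq_mul_div]
  ring

theorem memLp_top_of_numerator {a : Fin 3 → Complex.UnitDisc} {f : UnitAddCircle → ℂ}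
    {β : Fin 3 → ℂ} (hf : ∀ᵐ x ∂AddCircle.haarAddCircle,
      (blaschkeDenom a).eval (zvar x) * f x = formEval β (zvar x) 1) :
    MemLp f ∞ AddCircle.haarAddCircle := by
  have hcont : Continuous fun x => formEval β (zvar x) 1 / (blaschkeDenom a).eval (zvar x) :=
    ((continuous_formEval β 1).comp continuous_zvar).div
      ((blaschkeDenom a).continuous.comp continuous_zvar)
      fun x => eval_blaschkeDenom_ne_zero a (norm_zvar x).le
  refine (memLp_continuous hcont ∞).ae_eq ?_
  filter_upwards [hf] with x hx
  exact (eq_div_of_mul_eq (eval_blaschkeDenom_ne_zero a (norm_zvar x).le)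
    (by rw [mul_comm, hx])).symm

/-! ### Moments of a symbol -/

/-- Only the conjugated function needs a self-reciprocal numerator, so `g` may be any complex
combination of the basis. -/
theorem integral_conj_mul_mul {c : Circle} {a : Fin 3 → Complex.UnitDisc}
    {f g φ : UnitAddCircle → ℂ} (hφ : Integrable φ AddCircle.haarAddCircle) {β γ : Fin 3 → ℂ}
    (hβ : ∀ k, β k = c * conj (β k.rev))
    (hf : ∀ᵐ x ∂AddCircle.haarAddCircle,
      (blaschkeDenom a).eval (zvar x) * f x = formEval β (zvar x) 1)
    (hg : ∀ᵐ x ∂AddCircle.haarAddCircle,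
      (blaschkeDenom a).eval (zvar x) * g x = formEval γ (zvar x) 1) :
    ∫ x, conj (f x) * (φ x * g x) ∂AddCircle.haarAddCircle =
      ∑ i : Fin 3, ∑ j : Fin 3, β i * γ j *
        ∫ x, circleWeight c a (zvar x) * zvar x ^ (i + j : ℕ) * φ x ∂AddCircle.haarAddCircle := by
  have hint : ∀ m : ℕ, Integrable (fun x => circleWeight c a (zvar x) * zvar x ^ m * φ x)
      AddCircle.haarAddCircle := fun m => by
    rw [← memLp_one_iff_integrable] at hφ ⊢
    exact memLp_continuous_mul ((continuous_circleWeight_zvar c a).mul (continuous_zvar.pow m)) hφ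
  simp_rw [← integral_const_mul]
  simp_rw [← integral_finsetSum Finset.univ fun j _ => (hint _).const_mul _]
  rw [← integral_finsetSum Finset.univ fun i _ => integrable_finsetSum Finset.univ
    fun j _ => (hint _).const_mul _]
  refine integral_congr_ae ?_
  filter_upwards [hf, hg] with x hfx hgx
  have hq := eval_blaschkeDenom_ne_zero a (norm_zvar x).le
  have h := conj_div_mul_div (a := a) hβ γ (norm_zvar x)
  rw [← hfx, ← hgx, mul_div_cancel_left₀ _ hq, mul_div_cancel_left₀ _ hq, hfx, hgx, formEval,
    formEval, Finset.sum_mul_sum] at h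
  simp only [one_pow, mul_one] at h
  rw [mul_left_comm, h, Finset.mul_sum, Finset.mul_sum]
  refine Finset.sum_congr rfl fun i _ => ?_
  rw [Finset.mul_sum, Finset.mul_sum]
  refine Finset.sum_congr rfl fun j _ => ?_
  rw [pow_add]
  ring

theorem inner_orthogonalProjectionOnto_toLp {K : Submodule ℂ L2} [K.HasOrthogonalProjection]
    (f : K) {u : UnitAddCircle → ℂ} (hu : MemLp u 2 AddCircle.haarAddCircle) :
    inner ℂ f (K.orthogonalProjectionOnto hu.toLp) =
      ∫ x, conj ((f : L2) x) * u x ∂AddCircle.haarAddCircle := by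
  rw [Submodule.inner_orthogonalProjectionOnto_eq_of_mem_left, L2.inner_def]
  refine integral_congr_ae ?_
  filter_upwards [hu.coeFn_toLp] with x hx
  rw [hx, RCLike.inner_apply, mul_comm]

/-- The trigonometric polynomial, divided by the weight, that has the given moments. -/
noncomputable def momentSymbol (c : Circle) (a : Fin 3 → Complex.UnitDisc) (l : Fin 5 → ℂ)
    (x : UnitAddCircle) : ℂ :=
  (circleWeight c a (zvar x))⁻¹ * ∑ m : Fin 5, l m * fourier (-((m : ℕ) : ℤ)) x

theorem continuous_momentSymbol (c : Circle) (a : Fin 3 → Complex.UnitDisc) (l : Fin 5 → ℂ) :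
    Continuous (momentSymbol c a l) := by
  refine ((continuous_circleWeight_zvar c a).inv₀
    fun x => circleWeight_ne_zero c a (norm_zvar x)).mul
    (continuous_finsetSum _ fun m _ => continuous_const.mul (map_continuous _))

/-- The weight cancels, and orthonormality of the characters isolates `l m`. -/
theorem integral_momentSymbol (c : Circle) (a : Fin 3 → Complex.UnitDisc) (l : Fin 5 → ℂ)
    (m : Fin 5) :
    ∫ x, circleWeight c a (zvar x) * zvar x ^ (m : ℕ) * momentSymbol c a l x
      ∂AddCircle.haarAddCircle = l m := by
  have h : ∀ x, circleWeight c a (zvar x) * zvar x ^ (m : ℕ) * momentSymbol c a l x =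
      ∑ k : Fin 5, l k * (fourier (-((k : ℕ) : ℤ)) x • fourier ((m : ℕ) : ℤ) x) := by
    intro x
    have hw := circleWeight_ne_zero c a (norm_zvar x)
    rw [momentSymbol, mul_right_comm, ← mul_assoc, mul_inv_cancel₀ hw, one_mul, zvar_pow,
      Finset.sum_mul]
    simp only [smul_eq_mul, mul_assoc]
  simp_rw [h]
  rw [integral_finsetSum]
  · simp_rw [integral_const_mul]
    have h1 : ∀ k : Fin 5, ∫ x, fourier (-((k : ℕ) : ℤ)) x • fourier ((m : ℕ) : ℤ) x
        ∂(AddCircle.haarAddCircle : Measure UnitAddCircle) = if k = m then 1 else 0 := by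
      intro k
      have := congrFun (fourierCoeff_fourier (T := 1) ((m : ℕ) : ℤ)) ((k : ℕ) : ℤ)
      rw [fourierCoeff] at this
      rw [this, Pi.single_apply]
      simp [Fin.ext_iff]
    simp_rw [h1]
    simp
  · intro k _
    have hm : Integrable (fun x : UnitAddCircle => fourier ((m : ℕ) : ℤ) x)
        AddCircle.haarAddCircle :=
      memLp_one_iff_integrable.1 (memLp_continuous (map_continuous _) 1)
    exact (hm.fourier_smul _).const_mul _

/-! ### Matrices of truncated Toeplitz operators -/

section ModelSpace

variable {θ : ℂ → ℂ} {c : Circle} {a : Fin 3 → Complex.UnitDisc}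
  {v : OrthonormalBasis (Fin 3) ℂ (modelSpace θ)} {α : Fin 3 → Fin 3 → ℂ}

theorem numerator_sum_smul (hv : ∀ j, ∀ᵐ x ∂AddCircle.haarAddCircle,
      (blaschkeDenom a).eval (zvar x) * (v j : L2) x = formEval (α j) (zvar x) 1)
    (d : Fin 3 → ℂ) :
    ∀ᵐ x ∂AddCircle.haarAddCircle, (blaschkeDenom a).eval (zvar x) *
      ((∑ j, d j • v j : modelSpace θ) : L2) x = formEval (∑ j, d j • α j) (zvar x) 1 := by
  have h : ((∑ j, d j • v j : modelSpace θ) : L2) = ∑ j, d j • (v j : L2) := by simp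
  rw [h]
  filter_upwards [Lp.coeFn_fun_finsetSum Finset.univ fun j => d j • (v j : L2),
    ae_all_iff.2 fun j => Lp.coeFn_smul (d j) (v j : L2), ae_all_iff.2 hv] with x h1 h2 h3
  rw [h1, formEval_sum_smul, Finset.mul_sum]
  refine Finset.sum_congr rfl fun j _ => ?_
  rw [h2, Pi.smul_apply, smul_eq_mul, mul_left_comm, h3]

/-- Since `q` has no zero on the circle, a linear relation between the numerators is one between the
basis vectors. -/
theorem isUnit_of_numerator (hv : ∀ j, ∀ᵐ x ∂AddCircle.haarAddCircle,
      (blaschkeDenom a).eval (zvar x) * (v j : L2) x = formEval (α j) (zvar x) 1) :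
    IsUnit (Matrix.of α) := by
  rw [← Matrix.linearIndependent_rows_iff_isUnit]
  refine Fintype.linearIndependent_iff.2 fun d hd => ?_
  refine Fintype.linearIndependent_iff.1 v.toBasis.linearIndependent d ?_
  simp only [OrthonormalBasis.coe_toBasis]
  have hd' : ∑ j, d j • α j = 0 := hd
  refine Subtype.ext (Lp.ext ?_)
  filter_upwards [numerator_sum_smul hv d,
    Lp.coeFn_zero ℂ 2 (AddCircle.haarAddCircle : Measure UnitAddCircle)] with x h1 h2
  rw [hd'] at h1
  have h3 : formEval 0 (zvar x) 1 = 0 := by simp [formEval]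
  rw [Submodule.coe_zero, h2]
  exact (mul_eq_zero.1 (h1.trans h3)).resolve_left
    (eval_blaschkeDenom_ne_zero a (norm_zvar x).le)

theorem toMatrix_apply_eq_inner (A : modelSpace θ →ₗ[ℂ] modelSpace θ) (j k : Fin 3) :
    LinearMap.toMatrix v.toBasis v.toBasis A j k = inner ℂ (v j) (A (v k)) := by
  rw [LinearMap.toMatrix_apply, OrthonormalBasis.coe_toBasis_repr_apply,
    OrthonormalBasis.coe_toBasis, OrthonormalBasis.repr_apply_apply]

/-- The matrices of truncated Toeplitz operators are the matrices of moments. -/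
theorem exists_isTruncatedToeplitz_toMatrix_eq_iff
    (hα : ∀ j k, α j k = c * conj (α j k.rev))
    (hv : ∀ j, ∀ᵐ x ∂AddCircle.haarAddCircle,
      (blaschkeDenom a).eval (zvar x) * (v j : L2) x = formEval (α j) (zvar x) 1)
    (S : Matrix (Fin 3) (Fin 3) ℂ) :
    (∃ A : modelSpace θ →L[ℂ] modelSpace θ, IsTruncatedToeplitz θ A ∧
      LinearMap.toMatrix v.toBasis v.toBasis (A : modelSpace θ →ₗ[ℂ] modelSpace θ) = S) ↔
      ∃ l, congrHankel (Matrix.of α) l = S := by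
  constructor
  · rintro ⟨A, ⟨φ, hφ⟩, rfl⟩
    refine ⟨fun m => ∫ x, circleWeight c a (zvar x) * zvar x ^ (m : ℕ) * φ x
      ∂AddCircle.haarAddCircle, ?_⟩
    ext j k
    have h := hφ (v k) (memLp_top_of_numerator (hv k))
    rw [toMatrix_apply_eq_inner, ContinuousLinearMap.coe_coe, h,
      inner_orthogonalProjectionOnto_toLp, congrHankel_apply]
    exact (integral_conj_mul_mul (integrable_of_L2 φ) (hα j) (hv j) (hv k)).symm
  · rintro ⟨l, rfl⟩
    have : FiniteDimensional ℂ (modelSpace θ) := v.toBasis.finiteDimensional_of_finite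
    have hφm := memLp_continuous (continuous_momentSymbol c a l) 2
    set M := congrHankel (Matrix.of α) l with hM
    refine ⟨LinearMap.toContinuousLinearMap (Matrix.toLin v.toBasis v.toBasis M),
      ⟨hφm.toLp, fun f hf => ?_⟩, ?_⟩
    · refine InnerProductSpace.ext_inner_left_basis v.toBasis fun j => ?_
      rw [OrthonormalBasis.coe_toBasis, inner_orthogonalProjectionOnto_toLp]
      have hφ : ∀ m : Fin 5, ∫ x, circleWeight c a (zvar x) * zvar x ^ (m : ℕ) * (hφm.toLp : L2) x
          ∂AddCircle.haarAddCircle = l m := by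
        intro m
        rw [← integral_momentSymbol c a l m]
        refine integral_congr_ae ?_
        filter_upwards [hφm.coeFn_toLp] with x hx
        rw [hx]
      -- The symbol must be tested on every bounded `f`, so `f` is expanded in the basis.
      have hfn := numerator_sum_smul hv fun k => v.repr f k
      rw [v.sum_repr] at hfn
      have h := integral_conj_mul_mul (integrable_of_L2 hφm.toLp) (hα j) (hv j) hfn
      refine Eq.trans ?_ h.symm
      have h1 := congrFun (LinearMap.toMatrix_mulVec_repr v.toBasis v.toBasis
        (Matrix.toLin v.toBasis v.toBasis M) f) j
      rw [LinearMap.toMatrix_toLin, OrthonormalBasis.coe_toBasis_repr_apply,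
        OrthonormalBasis.repr_apply_apply] at h1
      rw [LinearMap.coe_toContinuousLinearMap', ← h1]
      simp only [Matrix.mulVec, dotProduct, OrthonormalBasis.coe_toBasis_repr_apply, hM,
        congrHankel_apply, Matrix.of_apply, Finset.sum_apply, Pi.smul_apply, smul_eq_mul,
        Finset.sum_mul, Finset.mul_sum]
      rw [Finset.sum_comm]
      refine Finset.sum_congr rfl fun i _ => ?_
      rw [Finset.sum_comm]
      refine Finset.sum_congr rfl fun m _ => Finset.sum_congr rfl fun k _ => ?_
      rw [← hφ]
      ring
    · rw [LinearMap.coe_toContinuousLinearMap, LinearMap.toMatrix_toLin]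

end ModelSpace

/-! ### Values of the basis and the columns -/

theorem tendsto_discValue {a : Fin 3 → Complex.UnitDisc} {f : L2} {α : Fin 3 → ℂ}
    (hf : ∀ z : ℂ, ‖z‖ < 1 → (blaschkeDenom a).eval z * discValue f z = formEval α z 1)
    (t : Circle) :
    Tendsto (fun r : ℝ => discValue f ((r : ℂ) * (t : ℂ))) (𝓝[<] (1 : ℝ))
      (𝓝 (formEval α t 1 / (blaschkeDenom a).eval (t : ℂ))) := by
  have hq := eval_blaschkeDenom_ne_zero a (Circle.norm_coe t).le
  have hr : Tendsto (fun r : ℝ => (r : ℂ) * (t : ℂ)) (𝓝[<] (1 : ℝ)) (𝓝 (t : ℂ)) := by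
    have h : Continuous fun r : ℝ => (r : ℂ) * (t : ℂ) := by fun_prop
    simpa using (h.tendsto 1).mono_left nhdsWithin_le_nhds
  have hlim := (((continuous_formEval α 1).tendsto (t : ℂ)).div
    ((blaschkeDenom a).continuous.tendsto (t : ℂ)) hq).comp hr
  refine hlim.congr' ?_
  filter_upwards [Ioo_mem_nhdsLT (show (0 : ℝ) < 1 by norm_num)] with r hr
  have hn : ‖(r : ℂ) * (t : ℂ)‖ < 1 := by
    rw [norm_mul, Circle.norm_coe, mul_one, Complex.norm_real, Real.norm_eq_abs,
      abs_of_pos hr.1]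
    exact hr.2
  exact (eq_div_of_mul_eq (eval_blaschkeDenom_ne_zero a hn.le)
    (by rw [mul_comm, hf _ hn])).symm

theorem circleColumn_eq_upperEntries (w : Fin 3 → ℂ) :
    circleColumn w = upperEntries (Matrix.of fun j k => w j * conj (w k)) := rfl

theorem discColumn_eq_upperEntries (w : Fin 3 → ℂ) :
    discColumn w = upperEntries (Matrix.of fun j k => conj (w j * w k)) := rfl

theorem circleColumn_eq_smul {c : Circle} {a : Fin 3 → Complex.UnitDisc} {α : Fin 3 → Fin 3 → ℂ}
    (hα : ∀ j k, α j k = c * conj (α j k.rev)) {t : ℂ} (ht : ‖t‖ = 1) {x y : Fin 5 → ℂ}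
    {i : Fin 5} (hx : x i = t) (hy : y i = 1) :
    circleColumn (fun j => formEval (α j) t 1 / (blaschkeDenom a).eval t) =
      circleWeight c a t •
        upperEntries (congrHankel (Matrix.of α) (Matrix.projVandermonde x y i)) := by
  rw [← map_smul, circleColumn_eq_upperEntries]
  congr 1
  ext j k
  -- The conjugated factor carries the index `k`; the product of forms is symmetric in `j` and `k`.
  rw [Matrix.smul_apply, congrHankel_projVandermonde, Matrix.of_apply, mul_comm,
    conj_div_mul_div (hα k) (α j) ht, hx, hy, smul_eq_mul, mul_comm (formEval (α k) t 1)]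
  rfl

/-- Both factors are conjugated, so each contributes `conj c / conj (q z)` and the symmetry is used
twice. -/
theorem discColumn_eq_smul {c : Circle} {a : Fin 3 → Complex.UnitDisc} {α : Fin 3 → Fin 3 → ℂ}
    (hα : ∀ j k, α j k = c * conj (α j k.rev)) (z : ℂ) {x y : Fin 5 → ℂ}
    {i : Fin 5} (hx : x i = 1) (hy : y i = conj z) :
    discColumn (fun j => formEval (α j) z 1 / (blaschkeDenom a).eval z) =
      (conj (c : ℂ) / conj ((blaschkeDenom a).eval z)) ^ 2 •
        upperEntries (congrHankel (Matrix.of α) (Matrix.projVandermonde x y i)) := by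
  rw [← map_smul, discColumn_eq_upperEntries]
  congr 1
  ext j k
  rw [Matrix.smul_apply, congrHankel_projVandermonde, Matrix.of_apply, hx, hy, smul_eq_mul,
    map_mul, map_div₀, map_div₀, conj_formEval (hα j), conj_formEval (hα k), map_one]
  change _ = _ * (formEval (α j) 1 (conj z) * formEval (α k) 1 (conj z))
  ring

end TTO

theorem mainTheorem1 (θ : ℂ → ℂ) (hθ : TTO.IsBlaschkeProduct 3 θ)
    (v : OrthonormalBasis (Fin 3) ℂ (TTO.modelSpace θ)) (hv : TTO.IsConjReal v)
    (t₁ t₂ t₃ : Circle) (ht₁₂ : t₁ ≠ t₂) (ht₁₃ : t₁ ≠ t₃) (ht₂₃ : t₂ ≠ t₃)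
    (l₄ l₅ : Complex.UnitDisc) (hl : l₄ ≠ l₅) :
    (∀ (t : Circle) (j : Fin 3),
      Tendsto (fun r : ℝ => TTO.discValue (v j : TTO.L2) ((r : ℂ) * (t : ℂ))) (𝓝[<] (1 : ℝ))
        (𝓝 (TTO.circleValue (v j : TTO.L2) t))) ∧
    ∀ s₁ s₂ s₃ s₄ s₅ s₆ : ℂ,
      (∃ A : TTO.modelSpace θ →L[ℂ] TTO.modelSpace θ, TTO.IsTruncatedToeplitz θ A ∧
        LinearMap.toMatrix v.toBasis v.toBasis (A : TTO.modelSpace θ →ₗ[ℂ] TTO.modelSpace θ) =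
          !![s₁, s₄, s₅; s₄, s₂, s₆; s₅, s₆, s₃]) ↔
      (TTO.ofColumns
        ![TTO.circleColumn fun j => TTO.circleValue (v j : TTO.L2) t₁,
          TTO.circleColumn fun j => TTO.circleValue (v j : TTO.L2) t₂,
          TTO.circleColumn fun j => TTO.circleValue (v j : TTO.L2) t₃,
          TTO.discColumn fun j => TTO.discValue (v j : TTO.L2) (l₄ : ℂ),
          TTO.discColumn fun j => TTO.discValue (v j : TTO.L2) (l₅ : ℂ),
          ![s₁, s₂, s₃, s₄, s₅, s₆]]).det = 0 := by
  obtain ⟨c, a, hθ⟩ := hθ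
  choose α hα hae hdisc using fun j => TTO.exists_numerator hθ (v j).2.1 (hv j)
  have hcircle : ∀ (t : Circle) (j : Fin 3), TTO.circleValue (v j : TTO.L2) t =
      TTO.formEval (α j) t 1 / (TTO.blaschkeDenom a).eval (t : ℂ) := fun t j =>
    (TTO.tendsto_discValue (hdisc j) t).limUnder_eq
  refine ⟨fun t j => by
    rw [hcircle]
    exact TTO.tendsto_discValue (hdisc j) t, fun s₁ s₂ s₃ s₄ s₅ s₆ => ?_⟩
  have hval : ∀ (z : Complex.UnitDisc) (j : Fin 3), TTO.discValue (v j : TTO.L2) (z : ℂ) =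
      TTO.formEval (α j) z 1 / (TTO.blaschkeDenom a).eval (z : ℂ) := fun z j =>
    eq_div_of_mul_eq (TTO.eval_blaschkeDenom_ne_zero a z.norm_lt_one.le)
      (by rw [mul_comm, hdisc j _ z.norm_lt_one])
  -- Homogeneous coordinates `(1, conj λ)` for the reflected point `1 / conj λ` also cover `λ = 0`.
  set x : Fin 5 → ℂ := ![t₁, t₂, t₃, 1, 1]
  set y : Fin 5 → ℂ := ![1, 1, 1, conj (l₄ : ℂ), conj (l₅ : ℂ)]
  set L := TTO.upperEntries ∘ₗ TTO.congrHankel (Matrix.of α)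
  set κ : Fin 5 → ℂ := ![TTO.circleWeight c a t₁, TTO.circleWeight c a t₂,
    TTO.circleWeight c a t₃, (conj (c : ℂ) / conj ((TTO.blaschkeDenom a).eval (l₄ : ℂ))) ^ 2,
    (conj (c : ℂ) / conj ((TTO.blaschkeDenom a).eval (l₅ : ℂ))) ^ 2]
  have hκ : ∀ i, κ i ≠ 0 := by
    have hd : ∀ z : Complex.UnitDisc,
        (conj (c : ℂ) / conj ((TTO.blaschkeDenom a).eval (z : ℂ))) ^ 2 ≠ 0 := fun z =>
      pow_ne_zero _ (div_ne_zero ((map_ne_zero _).2 (Circle.coe_ne_zero c))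
        ((map_ne_zero _).2 (TTO.eval_blaschkeDenom_ne_zero a z.norm_lt_one.le)))
    intro i
    fin_cases i
    · exact TTO.circleWeight_ne_zero c a (Circle.norm_coe t₁)
    · exact TTO.circleWeight_ne_zero c a (Circle.norm_coe t₂)
    · exact TTO.circleWeight_ne_zero c a (Circle.norm_coe t₃)
    · exact hd l₄
    · exact hd l₅
  have hxy : ∀ i j, i < j → x j * y i ≠ x i * y j := by
    -- A point of the circle differs from a reflected disc point by modulus.
    have hcd : ∀ (t : Circle) (z : Complex.UnitDisc), (1 : ℂ) * 1 ≠ t * conj (z : ℂ) := by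
      intro t z h
      have h1 := congrArg norm h
      rw [norm_mul, norm_mul, Circle.norm_coe, RCLike.norm_conj, norm_one, one_mul, one_mul] at h1
      exact z.norm_lt_one.ne h1.symm
    have hcc : ∀ {t u : Circle}, t ≠ u → (u : ℂ) * 1 ≠ t * 1 := fun h h' =>
      h (Circle.ext (by simpa using h'.symm))
    have hdd : (1 : ℂ) * conj (l₄ : ℂ) ≠ 1 * conj (l₅ : ℂ) := fun h => by
      rw [one_mul, one_mul] at h
      exact hl (Complex.UnitDisc.coe_injective ((starRingEnd ℂ).injective h))
    intro i j hij
    fin_cases i <;> fin_cases j <;> first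
      | exact absurd hij (by decide)
      | exact hcc ht₁₂
      | exact hcc ht₁₃
      | exact hcc ht₂₃
      | exact hcd _ _
      | exact hdd
  have hcols : (![TTO.circleColumn fun j => TTO.circleValue (v j : TTO.L2) t₁,
      TTO.circleColumn fun j => TTO.circleValue (v j : TTO.L2) t₂,
      TTO.circleColumn fun j => TTO.circleValue (v j : TTO.L2) t₃,
      TTO.discColumn fun j => TTO.discValue (v j : TTO.L2) (l₄ : ℂ),
      TTO.discColumn fun j => TTO.discValue (v j : TTO.L2) (l₅ : ℂ),
      ![s₁, s₂, s₃, s₄, s₅, s₆]] : Fin 6 → Fin 6 → ℂ) =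
      Fin.snoc (fun i => κ i • L ((Matrix.projVandermonde x y).row i))
        ![s₁, s₂, s₃, s₄, s₅, s₆] := by
    simp only [hcircle, hval]
    funext i
    fin_cases i
    · exact TTO.circleColumn_eq_smul hα (Circle.norm_coe t₁) (i := 0) rfl rfl
    · exact TTO.circleColumn_eq_smul hα (Circle.norm_coe t₂) (i := 1) rfl rfl
    · exact TTO.circleColumn_eq_smul hα (Circle.norm_coe t₃) (i := 2) rfl rfl
    · exact TTO.discColumn_eq_smul hα (l₄ : ℂ) (i := 3) rfl rfl
    · exact TTO.discColumn_eq_smul hα (l₅ : ℂ) (i := 4) rfl rfl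
    · rfl
  rw [hcols, TTO.det_ofColumns_snoc_eq_zero_iff L
    (TTO.upperEntries_comp_congrHankel_injective (TTO.isUnit_of_numerator hae))
    (TTO.linearIndependent_projVandermonde hxy) hκ,
    TTO.exists_isTruncatedToeplitz_toMatrix_eq_iff hα hae]
  have hsymm : (!![s₁, s₄, s₅; s₄, s₂, s₆; s₅, s₆, s₃] : Matrix (Fin 3) (Fin 3) ℂ).IsSymm := by
    ext i j
    fin_cases i <;> fin_cases j <;> rfl
  refine exists_congr fun l => ⟨fun h => ?_, fun h => ?_⟩
  · exact congrArg TTO.upperEntries h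
  · exact TTO.upperEntries_injOn_isSymm (TTO.isSymm_congrHankel _ l) hsymm h
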